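/- Let $\gamma>0$ and write $\mathcal S=\mathcal S(\mathbb R)$ for the Schwartz space and $\mathcal S'$ for the tempered distributions. For $F\in\mathcal S'$, $\varphi\in\mathcal S$ put $\langle\varphi|F\rangle:=F(\overline{\varphi})$ and $\langle F|\varphi\rangle:=\overline{\langle\varphi|F\rangle}$. Let $F[\varphi](k)=\frac1{\sqrt{2\pi}}\int e^{ikx}\varphi(x)\,dx$ on $\mathcal S$, and $F[T](\varphi)=T(F[\varphi])$ on $\mathcal S'$; put $\mathcal Z=\{F[u] : u\in C_c^\infty(\mathbb R)\}$. Let $H=-\frac{\gamma}{2}(\hat x\hat p+\hat p\hat x)=i\gamma\left(x\frac{d}{dx}+\frac12\right)$. A nonzero $F\in\mathcal S'$ is a generalized eigenvector of $H$ with eigenvalue $\lambda$ if $\langle H\varphi|F\rangle=\lambda\langle\varphi|F\rangle$ for all $\varphi\in\mathcal S$. For $E\in\mathbb R$ let $\psi^E_\pm=\frac1{\sqrt{2\pi\gamma}}\,x_\pm^{-(iE/\gamma+1/2)}\in\mathcal S'$, where $x_+^\lambda=x^\lambda$ for $x>0$ and $0$ for $x<0$, and $x_-^\lambda=|x|^\lambda$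 for $x<0$ and $0$ for $x>0$. Let $\mathcal H^2_+$ (resp. $\mathcal H^2_-$) be the class of smooth $f:\mathbb R\to\mathbb C$ that are the boundary values of a function $g$ which is analytic in the open upper (resp. lower) half-plane, continuous on the closed half-plane, and satisfies $|z|^k|g(z)|\to0$ for every $k\in\mathbb N$ as $|z|\to\infty$ in the closed half-plane. Define $$\Phi_-=\{\varphi\in\mathcal S : \ E\mapsto\langle\psi^E_+|\varphi\rangle \text{ and } E\mapsto\langle\psi^E_-|\varphi\rangle \text{ belong to } \mathcal H^2_-\},$$ $$\Phi_+=\{\varphi\in\mathcal S : \ E\mapsto\langle F[\psi^{-E}_+]|\varphi\rangle \text{ and } E\mapsto\langle F[\psi^{-E}_-]|\varphi\rangle \text{ belong to } \mathcal H^2_+\}.$$ Finally, for $n=0,1,2,\dots$ let $f^-_n=\frac{(-1)^n}{\sqrt{n!}}\delta^{(n)}$ and $f^+_n(x)=\frac{x^n}{\sqrt{n!}}$, as elements of $\mathcal S'$. **Theorem.** 1. For every $n$, $f^\pm_n$ is a generalized eigenvector of $H$ with eigenvalue $\pm i\gamma\left(n+\frac12\right)$. 2. Every $\varphi^-\in\Phi_-$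 expands as $\varphi^-=\sum_{n\ge0}f^-_n\,\langle f^+_n|\varphi^-\rangle$, in the sense of weak convergence of functionals on $\mathcal Z$: for every $\chi\in\mathcal Z$, $$\sum_{n\ge0} f^-_n(\chi)\,\langle f^+_n|\varphi^-\rangle=\int_{\mathbb R}\varphi^-(x)\chi(x)\,dx,$$ the series converging absolutely. 3. Every $\varphi^+\in\Phi_+$ expands as $$\varphi^+(x)=\sum_{n\ge0}f^+_n(x)\,\langle f^-_n|\varphi^+\rangle\qquad\text{for every }x\in\mathbb R,$$ the series converging absolutely. -/

import Mathlib

open MeasureTheory Filter Topology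
open scoped SchwartzMap ContDiff

namespace DampedSystem

noncomputable section

/-! ### The Dirac bracket between test functions and tempered distributions -/

/-- Complex conjugation `φ ↦ conj φ` on the Schwartz space. -/
def conjS : 𝓢(ℝ, ℂ) →L[ℝ] 𝓢(ℝ, ℂ) :=
  SchwartzMap.postcompCLM (𝕜 := ℝ) Complex.conjCLE.toContinuousLinearMap

/-- The Dirac bracket `⟨φ | F⟩ = ∫ conj (φ x) * F x dx`, antilinear in `φ`, linear in `F`. -/
def braKet (φ : 𝓢(ℝ, ℂ)) (F : 𝓢'(ℝ, ℂ)) : ℂ := F (conjS φ)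

/-- The Dirac bracket `⟨F | φ⟩ = conj ⟨φ | F⟩ = ∫ conj (F x) * φ x dx`, linear in `φ`. -/
def ketBra (F : 𝓢'(ℝ, ℂ)) (φ : 𝓢(ℝ, ℂ)) : ℂ := (starRingEnd ℂ) (braKet φ F)

/-! ### The Fourier transform `F[φ](k) = (2π)^(-1/2) ∫ exp(ikx) φ(x) dx` -/

/-- The dilation `k ↦ k / (2π)` of the real line. -/
def dilation : ℝ ≃L[ℝ] ℝ :=
  ContinuousLinearEquiv.unitsEquivAut ℝ
    (Units.mk0 ((2 * Real.pi)⁻¹) (inv_ne_zero Real.two_pi_pos.ne'))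

/-- `F[φ](k) = (2π)^(-1/2) ∫ exp(ikx) φ(x) dx` on the Schwartz space (see `fourierS_apply`). -/
def fourierS : 𝓢(ℝ, ℂ) →L[ℂ] 𝓢(ℝ, ℂ) :=
  (((Real.sqrt (2 * Real.pi))⁻¹ : ℝ) : ℂ) •
    ((SchwartzMap.compCLMOfContinuousLinearEquiv ℂ dilation).comp
      (FourierTransform.fourierInvCLM ℂ 𝓢(ℝ, ℂ)))

theorem fourierS_apply (φ : 𝓢(ℝ, ℂ)) (k : ℝ) :
    fourierS φ k = (((Real.sqrt (2 * Real.pi))⁻¹ : ℝ) : ℂ) *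
      ∫ x : ℝ, Complex.exp (Complex.I * k * x) * φ x := by
  have h : fourierS φ k = (((Real.sqrt (2 * Real.pi))⁻¹ : ℝ) : ℂ) *
      (FourierTransform.fourierInv (φ : ℝ → ℂ)) (dilation k) := by
    rw [← SchwartzMap.fourierInv_coe]
    rfl
  rw [h, Real.fourierInv_eq']
  congr 1
  refine integral_congr_ae (Eventually.of_forall fun x => ?_)
  have hd : dilation k = k * (2 * Real.pi)⁻¹ := rfl
  have hp : 2 * Real.pi * inner ℝ x (dilation k) = k * x := by
    rw [hd]
    simp only [RCLike.inner_apply, conj_trivial]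
    field_simp
  simp only [hp, smul_eq_mul]
  congr 2
  push_cast
  ring

/-- The Fourier transform of tempered distributions, `F[T](φ) = T(F[φ])`. -/
def fourierD (T : 𝓢'(ℝ, ℂ)) : 𝓢'(ℝ, ℂ) :=
  PointwiseConvergenceCLM.precomp ℂ fourierS T

/-- The space `Z = {F[u] | u smooth with compact support}`. -/
def spaceZ : Set 𝓢(ℝ, ℂ) := {χ | ∃ u : 𝓢(ℝ, ℂ), HasCompactSupport u ∧ χ = fourierS u}

/-! ### The Hamiltonian and generalized eigenvectors -/

/-- The position operator `(x̂ φ)(x) = x φ(x)`. -/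
def xOp : 𝓢(ℝ, ℂ) →L[ℂ] 𝓢(ℝ, ℂ) := SchwartzMap.smulLeftCLM ℂ (fun x : ℝ => (x : ℂ))

/-- The momentum operator `p̂ φ = -i φ'`. -/
def pOp : 𝓢(ℝ, ℂ) →L[ℂ] 𝓢(ℝ, ℂ) := (-Complex.I) • SchwartzMap.derivCLM ℂ ℂ

/-- The Hamiltonian `Ĥ = -(γ/2) (x̂ p̂ + p̂ x̂)`. -/
def hamiltonian (γ : ℝ) : 𝓢(ℝ, ℂ) →L[ℂ] 𝓢(ℝ, ℂ) :=
  (-((γ : ℂ) / 2)) • (xOp.comp pOp + pOp.comp xOp)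

/-- `F` is a generalized eigenvector of `A` with generalized eigenvalue `l`:
`F ≠ 0` and `⟨A φ | F⟩ = l ⟨φ | F⟩` for all `φ`. -/
def IsGenEigenvector (A : 𝓢(ℝ, ℂ) →L[ℂ] 𝓢(ℝ, ℂ)) (l : ℂ) (F : 𝓢'(ℝ, ℂ)) : Prop :=
  F ≠ 0 ∧ ∀ φ : 𝓢(ℝ, ℂ), braKet (A φ) F = l * braKet φ F

/-! ### The resonant families -/

/-- The function `x ↦ x ^ n / √(n!)`. -/
def fPlusFun (n : ℕ) (x : ℝ) : ℂ := (x : ℂ) ^ n / (Real.sqrt (n.factorial) : ℂ)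

theorem fPlusFun_hasTemperateGrowth (n : ℕ) : (fPlusFun n).HasTemperateGrowth := by
  have h0 : (fun x : ℝ => (x : ℂ)).HasTemperateGrowth := Complex.ofRealCLM.hasTemperateGrowth
  have h := (h0.pow n).mul
    (Function.HasTemperateGrowth.const (E := ℝ) ((Real.sqrt (n.factorial) : ℂ)⁻¹))
  have e : fPlusFun n =
      (fun x : ℝ => (x : ℂ)) ^ n * (fun _ : ℝ => ((Real.sqrt (n.factorial) : ℂ)⁻¹)) := by
    funext x
    simp [fPlusFun, div_eq_mul_inv]
  rw [e]
  exact h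

/-- The tempered distribution `f⁺_n = x ^ n / √(n!)`. -/
def fPlus (n : ℕ) : 𝓢'(ℝ, ℂ) :=
  Function.HasTemperateGrowth.toTemperedDistribution volume (fPlusFun_hasTemperateGrowth n)

/-- The tempered distribution `f⁻_n = (-1)^n δ^(n) / √(n!)`. -/
def fMinus (n : ℕ) : 𝓢'(ℝ, ℂ) :=
  ((-1 : ℂ) ^ n / (Real.sqrt (n.factorial) : ℂ)) •
    (TemperedDistribution.derivCLM ℂ)^[n] (TemperedDistribution.delta (0 : ℝ))

/-! ### The energy eigenvectors -/

/-- The function `x_+^l`. -/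
def xPlus (l : ℂ) (x : ℝ) : ℂ := if 0 ≤ x then (x : ℂ) ^ l else 0

/-- The function `x_-^l`. -/
def xMinus (l : ℂ) (x : ℝ) : ℂ := if 0 ≤ x then 0 else ((|x| : ℝ) : ℂ) ^ l

/-- The exponent `-(iE/γ + 1/2)`. -/
def expo (γ E : ℝ) : ℂ := -(Complex.I * E / γ + 1 / 2)

theorem expo_re (γ E : ℝ) : (expo γ E).re = -1 / 2 := by
  have h : Complex.I * E / γ = Complex.I * ((E / γ : ℝ) : ℂ) := by push_cast; ring
  rw [expo, h]
  norm_num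

/-- The function `(1 + |x|)⁻¹ f` is integrable on the line. -/
def WeightIntegrable (f : ℝ → ℂ) : Prop := Integrable (fun x : ℝ => (1 + |x|)⁻¹ • f x)

theorem weight_bound (φ : 𝓢(ℝ, ℂ)) (x : ℝ) :
    ‖φ x‖ ≤ (2 * (Finset.Iic (1, 0)).sup (schwartzSeminormFamily ℂ ℝ ℂ) φ) * (1 + |x|)⁻¹ := by
  have h := SchwartzMap.one_add_le_sup_seminorm_apply (𝕜 := ℂ) (m := (1, 0)) (k := 1) (n := 0)
    le_rfl le_rfl φ x
  have hx : 0 < 1 + |x| := by positivity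
  rw [← div_eq_mul_inv, le_div_iff₀ hx, mul_comm]
  simpa [norm_iteratedFDeriv_zero] using! h

theorem mul_bound (f : ℝ → ℂ) (φ : 𝓢(ℝ, ℂ)) (x : ℝ) :
    ‖f x * φ x‖ ≤ (2 * (Finset.Iic (1, 0)).sup (schwartzSeminormFamily ℂ ℝ ℂ) φ) *
      ‖(1 + |x|)⁻¹ • f x‖ := by
  have hx : 0 < 1 + |x| := by positivity
  rw [norm_mul, norm_smul, Real.norm_of_nonneg (inv_nonneg.2 hx.le)]
  calc ‖f x‖ * ‖φ x‖ ≤ ‖f x‖ *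
        ((2 * (Finset.Iic (1, 0)).sup (schwartzSeminormFamily ℂ ℝ ℂ) φ) * (1 + |x|)⁻¹) := by
        gcongr
        exact weight_bound φ x
    _ = _ := by ring

theorem WeightIntegrable.integrable_mul {f : ℝ → ℂ} (hf : WeightIntegrable f) (φ : 𝓢(ℝ, ℂ)) :
    Integrable (fun x => f x * φ x) := by
  have hm : AEStronglyMeasurable f := by
    have h2 : AEStronglyMeasurable (fun x : ℝ => (1 + |x|) • ((1 + |x|)⁻¹ • f x)) :=
      (by fun_prop : Continuous fun x : ℝ => (1 + |x|)).aestronglyMeasurable.smul hf.1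
    refine h2.congr (Eventually.of_forall fun x => ?_)
    have hx : (1 + |x|) ≠ 0 := by positivity
    simp only [smul_smul, mul_inv_cancel₀ hx, one_smul]
  refine Integrable.mono' (hf.norm.const_mul
    (2 * (Finset.Iic (1, 0)).sup (schwartzSeminormFamily ℂ ℝ ℂ) φ))
    (hm.mul φ.continuous.aestronglyMeasurable) (Eventually.of_forall fun x => mul_bound f φ x)

/-- The regular tempered distribution `φ ↦ ∫ f x * φ x dx` of a function `f` such that
`(1 + |x|)⁻¹ f` is integrable. -/
def regular (f : ℝ → ℂ) (hf : WeightIntegrable f) : 𝓢'(ℝ, ℂ) :=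
  ContinuousLinearMap.toPointwiseConvergenceCLM ℂ (RingHom.id ℂ) 𝓢(ℝ, ℂ) ℂ
    (SchwartzMap.mkCLMtoNormedSpace (σ := RingHom.id ℂ) (fun φ : 𝓢(ℝ, ℂ) => ∫ x, f x * φ x)
      (fun φ ψ => by
        rw [← integral_add (hf.integrable_mul φ) (hf.integrable_mul ψ)]
        refine integral_congr_ae (Eventually.of_forall fun x => ?_)
        simp [mul_add])
      (fun a φ => by
        rw [RingHom.id_apply, smul_eq_mul, ← integral_const_mul]
        refine integral_congr_ae (Eventually.of_forall fun x => ?_)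
        simp only [smul_apply, smul_eq_mul]
        ring)
      ⟨Finset.Iic (1, 0), 2 * ∫ x, ‖(1 + |x|)⁻¹ • f x‖, by positivity, fun φ => by
        refine (norm_integral_le_integral_norm _).trans ?_
        refine (integral_mono (hf.integrable_mul φ).norm
          (hf.norm.const_mul _) (fun x => mul_bound f φ x)).trans (le_of_eq ?_)
        rw [integral_const_mul]
        ring⟩)

theorem regular_apply (f : ℝ → ℂ) (hf : WeightIntegrable f) (φ : 𝓢(ℝ, ℂ)) :
    regular f hf φ = ∫ x, f x * φ x := rfl

theorem integrableOn_weight :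
    IntegrableOn (fun x : ℝ => (1 + x)⁻¹ * x ^ (-1 / 2 : ℝ)) (Set.Ioi 0) := by
  have hmeas : Measurable (fun x : ℝ => (1 + x)⁻¹ * x ^ (-1 / 2 : ℝ)) := by fun_prop
  rw [← Set.Ioc_union_Ioi_eq_Ioi (zero_le_one (α := ℝ))]
  refine IntegrableOn.union ?_ ?_
  · have h : IntegrableOn (fun x : ℝ => x ^ (-1 / 2 : ℝ)) (Set.Ioc 0 1) :=
      (intervalIntegrable_iff_integrableOn_Ioc_of_le zero_le_one).1
        (intervalIntegral.intervalIntegrable_rpow' (by norm_num))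
    refine Integrable.mono' h hmeas.aestronglyMeasurable ?_
    refine (ae_restrict_iff' measurableSet_Ioc).2 (Eventually.of_forall fun x hx => ?_)
    have h1 : 0 ≤ x ^ (-1 / 2 : ℝ) := Real.rpow_nonneg hx.1.le _
    have h2 : (1 + x)⁻¹ ≤ 1 := inv_le_one_of_one_le₀ (by linarith [hx.1])
    have h3 : 0 ≤ (1 + x)⁻¹ := inv_nonneg.2 (by linarith [hx.1])
    rw [Real.norm_of_nonneg (mul_nonneg h3 h1)]
    nlinarith
  · have h : IntegrableOn (fun x : ℝ => x ^ (-3 / 2 : ℝ)) (Set.Ioi 1) :=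
      integrableOn_Ioi_rpow_of_lt (by norm_num) one_pos
    refine Integrable.mono' h hmeas.aestronglyMeasurable ?_
    refine (ae_restrict_iff' measurableSet_Ioi).2 (Eventually.of_forall fun x hx => ?_)
    have hx0 : 0 < x := one_pos.trans hx
    have h1 : 0 ≤ x ^ (-1 / 2 : ℝ) := Real.rpow_nonneg hx0.le _
    have h2 : (1 + x)⁻¹ ≤ x⁻¹ := inv_anti₀ hx0 (by linarith)
    have h3 : 0 ≤ (1 + x)⁻¹ := inv_nonneg.2 (by linarith)
    rw [Real.norm_of_nonneg (mul_nonneg h3 h1)]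
    calc (1 + x)⁻¹ * x ^ (-1 / 2 : ℝ) ≤ x⁻¹ * x ^ (-1 / 2 : ℝ) := by gcongr
      _ = x ^ (-3 / 2 : ℝ) := by
        rw [← Real.rpow_neg_one, ← Real.rpow_add hx0]
        norm_num

theorem weightIntegrable_xPlus {l : ℂ} (hl : l.re = -1 / 2) : WeightIntegrable (xPlus l) := by
  have e : (fun x : ℝ => (1 + |x|)⁻¹ • xPlus l x) =
      Set.indicator (Set.Ici 0) (fun x : ℝ => (1 + |x|)⁻¹ • (x : ℂ) ^ l) := by
    funext x
    by_cases hx : 0 ≤ x <;> simp [xPlus, Set.indicator, hx]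
  rw [WeightIntegrable, e, integrable_indicator_iff measurableSet_Ici,
    integrableOn_Ici_iff_integrableOn_Ioi]
  refine Integrable.mono' integrableOn_weight
    (by fun_prop : Measurable (fun x : ℝ => (1 + |x|)⁻¹ • (x : ℂ) ^ l)).aestronglyMeasurable ?_
  refine (ae_restrict_iff' measurableSet_Ioi).2 (Eventually.of_forall fun x hx => ?_)
  have hx0 : 0 < x := hx
  have h3 : 0 ≤ (1 + x)⁻¹ := inv_nonneg.2 (by linarith)
  rw [norm_smul, Complex.norm_cpow_eq_rpow_re_of_pos hx0, hl, abs_of_pos hx0,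
    Real.norm_of_nonneg h3]

theorem weightIntegrable_xMinus {l : ℂ} (hl : l.re = -1 / 2) : WeightIntegrable (xMinus l) := by
  have h := (weightIntegrable_xPlus hl).comp_neg
  refine h.congr ?_
  have h0 : ∀ᵐ x : ℝ, x ≠ 0 := by simp [ae_iff, measure_singleton]
  filter_upwards [h0] with x hx
  rcases lt_or_gt_of_ne hx with hx | hx
  · have h1 : (0 : ℝ) ≤ -x := by linarith
    simp [xPlus, xMinus, hx.not_ge, hx.le, abs_of_neg hx]
  · simp [xPlus, xMinus, hx.le, hx.not_ge]

/-- The energy eigenvector `ψ^E_+ = (2πγ)^(-1/2) x_+^(-(iE/γ + 1/2))`. -/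
def psiPlus (γ E : ℝ) : 𝓢'(ℝ, ℂ) :=
  (((Real.sqrt (2 * Real.pi * γ))⁻¹ : ℝ) : ℂ) •
    regular (xPlus (expo γ E)) (weightIntegrable_xPlus (expo_re γ E))

/-- The energy eigenvector `ψ^E_- = (2πγ)^(-1/2) x_-^(-(iE/γ + 1/2))`. -/
def psiMinus (γ E : ℝ) : 𝓢'(ℝ, ℂ) :=
  (((Real.sqrt (2 * Real.pi * γ))⁻¹ : ℝ) : ℂ) •
    regular (xMinus (expo γ E)) (weightIntegrable_xMinus (expo_re γ E))

/-! ### The Hardy classes and the spaces `Φ₋`, `Φ₊` -/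

/-- The Hardy class from above: smooth functions on the line that are the boundary values of a
function analytic in the upper half-plane, continuous up to the line, and vanishing faster than
any power of `|z|` as `|z| → ∞` in the closed upper half-plane. -/
def HardyAbove (f : ℝ → ℂ) : Prop :=
  ContDiff ℝ ∞ f ∧ ∃ g : ℂ → ℂ,
    DifferentiableOn ℂ g {z | 0 < z.im} ∧ ContinuousOn g {z | 0 ≤ z.im} ∧
    (∀ E : ℝ, g E = f E) ∧
    ∀ k : ℕ, Tendsto (fun z : ℂ => ‖z‖ ^ k * ‖g z‖)
      (Bornology.cobounded ℂ ⊓ 𝓟 {z | 0 ≤ z.im}) (𝓝 0)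

/-- The Hardy class from below: as `HardyAbove`, for the lower half-plane. -/
def HardyBelow (f : ℝ → ℂ) : Prop :=
  ContDiff ℝ ∞ f ∧ ∃ g : ℂ → ℂ,
    DifferentiableOn ℂ g {z | z.im < 0} ∧ ContinuousOn g {z | z.im ≤ 0} ∧
    (∀ E : ℝ, g E = f E) ∧
    ∀ k : ℕ, Tendsto (fun z : ℂ => ‖z‖ ^ k * ‖g z‖)
      (Bornology.cobounded ℂ ⊓ 𝓟 {z | z.im ≤ 0}) (𝓝 0)

/-- `Φ₋`: Schwartz functions for which both `E ↦ ⟨ψ^E_± | φ⟩` are of Hardy class from below. -/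
def PhiMinus (γ : ℝ) : Set 𝓢(ℝ, ℂ) :=
  {φ | HardyBelow (fun E => ketBra (psiPlus γ E) φ) ∧
    HardyBelow (fun E => ketBra (psiMinus γ E) φ)}

/-- `Φ₊`: Schwartz functions for which both `E ↦ ⟨F[ψ^(-E)_±] | φ⟩` are of Hardy class from
above. -/
def PhiPlus (γ : ℝ) : Set 𝓢(ℝ, ℂ) :=
  {φ | HardyAbove (fun E => ketBra (fourierD (psiPlus γ (-E))) φ) ∧
    HardyAbove (fun E => ketBra (fourierD (psiMinus γ (-E))) φ)}

end

end DampedSystem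

namespace DampedSystem

/-! ### Basic evaluation formulas -/

/-! Since `H = iγ (d/dx ∘ x - 1/2)`, the eigenvalue equations come from one integration by parts for
`x ^ n` and from Leibniz' rule at `0` for `δ^(n)`.

Both expansions rest on one fact: functions in `Φ₋` vanish where `|x| ≥ 1`
(`eq_zero_of_mem_PhiMinus`). Up to a constant, `⟨ψ^E_+ | φ⟩` is the Mellin transform of `φ` at `1/2
+ iE/γ`, so Mellin inversion writes `φ x`, for `x > 0`, as a multiple of the integral over `E` of
`exp (-i (log x / γ) E) ⟨ψ^E_+ | φ⟩`. For `x ≥ 1` the exponential is bounded in the lower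
half-plane, and closing the contour there gives `0`. Reflection treats `x ≤ -1`.

The Fourier transform of a function with bounded support is the sum of its Taylor series at `0`
(`hasSum_taylor_fourierS`). For `χ = F[u]` in `Z`, integrating this series against `φ ∈ Φ₋` termwise
gives the first expansion: the moments of `φ` stay bounded because its support lies in `[-1, 1]`.
For `φ ∈ Φ₊`, the inverse transform `conj F conj φ` lies in `Φ₋`, so `φ` is itself such a Fourier
transform and its Taylor series is the second expansion.

`HasSum` in `ℂ` is unconditional, hence absolute, convergence. -/

theorem conjS_apply (φ : 𝓢(ℝ, ℂ)) (x : ℝ) : conjS φ x = (starRingEnd ℂ) (φ x) := rfl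

theorem conjS_conjS (φ : 𝓢(ℝ, ℂ)) : conjS (conjS φ) = φ := by
  ext x
  simp [conjS_apply]

theorem xOp_apply (φ : 𝓢(ℝ, ℂ)) (x : ℝ) : xOp φ x = x * φ x := by
  have h : (fun x : ℝ => (x : ℂ)).HasTemperateGrowth := Complex.ofRealCLM.hasTemperateGrowth
  rw [xOp, SchwartzMap.smulLeftCLM_apply_apply h, smul_eq_mul]

theorem pOp_apply (φ : 𝓢(ℝ, ℂ)) (x : ℝ) : pOp φ x = -Complex.I * deriv φ x := by
  simp [pOp]

theorem deriv_xOp (φ : 𝓢(ℝ, ℂ)) (x : ℝ) : deriv (xOp φ) x = φ x + x * deriv φ x := by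
  have e : (xOp φ : ℝ → ℂ) = fun x : ℝ => (x : ℂ) * φ x := funext (xOp_apply φ)
  have h := (Complex.ofRealCLM.hasDerivAt (x := x)).mul (φ.hasDerivAt x)
  rw [e]
  simpa using! h.deriv

theorem hamiltonian_apply (γ : ℝ) (φ : 𝓢(ℝ, ℂ)) (x : ℝ) :
    hamiltonian γ φ x = Complex.I * γ * (x * deriv φ x + φ x / 2) := by
  have h : pOp (xOp φ) x = -Complex.I * (φ x + x * deriv φ x) := by
    rw [pOp_apply, deriv_xOp]
  simp only [hamiltonian, smul_apply, ContinuousLinearMap.comp_apply, add_apply, smul_eq_mul, h]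
  rw [xOp_apply, pOp_apply]
  ring

theorem derivCLM_conjS (φ : 𝓢(ℝ, ℂ)) :
    SchwartzMap.derivCLM ℂ ℂ (conjS φ) = conjS (SchwartzMap.derivCLM ℂ ℂ φ) := by
  ext x
  rw [SchwartzMap.derivCLM_apply, conjS_apply, SchwartzMap.derivCLM_apply]
  exact (Complex.conjCLE.toContinuousLinearMap.hasFDerivAt.comp_hasDerivAt x
    (φ.hasDerivAt x)).deriv

theorem iterate_derivCLM_conjS (n : ℕ) (φ : 𝓢(ℝ, ℂ)) :
    (SchwartzMap.derivCLM ℂ ℂ)^[n] (conjS φ) = conjS ((SchwartzMap.derivCLM ℂ ℂ)^[n] φ) :=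
  ((show Function.Commute (SchwartzMap.derivCLM ℂ ℂ) conjS from derivCLM_conjS).iterate_left n) φ

/-- The coefficients of `H` are purely imaginary, so conjugation flips its sign; this is the source
of the minus sign in the unconjugated eigenvalue equations. -/
theorem conjS_hamiltonian (γ : ℝ) (φ : 𝓢(ℝ, ℂ)) :
    conjS (hamiltonian γ φ) = -hamiltonian γ (conjS φ) := by
  ext x
  have h := congrArg (fun f : 𝓢(ℝ, ℂ) => f x) (derivCLM_conjS φ)
  simp only [SchwartzMap.derivCLM_apply, conjS_apply] at h
  rw [neg_apply, conjS_apply, hamiltonian_apply, hamiltonian_apply, h, conjS_apply]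
  simp only [map_mul, map_add, map_div₀, Complex.conj_I, Complex.conj_ofReal, map_ofNat]
  ring

theorem isGenEigenvector_of_forall_apply {γ : ℝ} {l : ℂ} {F : 𝓢'(ℝ, ℂ)}
    (hF : ∃ φ : 𝓢(ℝ, ℂ), F φ ≠ 0) (h : ∀ φ : 𝓢(ℝ, ℂ), F (hamiltonian γ φ) = -(l * F φ)) :
    IsGenEigenvector (hamiltonian γ) l F := by
  refine ⟨?_, fun φ => ?_⟩
  · rintro rfl
    obtain ⟨φ, hφ⟩ := hF
    exact hφ rfl
  · rw [braKet, braKet, conjS_hamiltonian, map_neg, h, neg_neg]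

/-! ### The distributions `f⁺_n` and `f⁻_n` -/

theorem fPlus_apply (n : ℕ) (φ : 𝓢(ℝ, ℂ)) :
    fPlus n φ = ∫ x : ℝ, φ x * fPlusFun n x := rfl

theorem iterate_derivCLM_tempered_apply (n : ℕ) (T : 𝓢'(ℝ, ℂ)) (φ : 𝓢(ℝ, ℂ)) :
    (TemperedDistribution.derivCLM ℂ)^[n] T φ =
      (-1) ^ n * T ((SchwartzMap.derivCLM ℂ ℂ)^[n] φ) := by
  induction n generalizing φ with
  | zero => simp
  | succ n ih =>
    rw [Function.iterate_succ_apply', TemperedDistribution.derivCLM_apply_apply, map_neg, ih,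
      ← Function.iterate_succ_apply, pow_succ]
    ring

theorem fMinus_apply (n : ℕ) (φ : 𝓢(ℝ, ℂ)) :
    fMinus n φ = (Real.sqrt n.factorial : ℂ)⁻¹ * (SchwartzMap.derivCLM ℂ ℂ)^[n] φ 0 := by
  have h : fMinus n φ = ((-1 : ℂ) ^ n / (Real.sqrt (n.factorial) : ℂ)) *
    (TemperedDistribution.derivCLM ℂ)^[n] (TemperedDistribution.delta (0 : ℝ)) φ := rfl
  rw [h, iterate_derivCLM_tempered_apply, TemperedDistribution.delta_apply]
  have h1 : (-1 : ℂ) ^ n * (-1) ^ n = 1 := by rw [← mul_pow]; simp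
  linear_combination (Real.sqrt n.factorial : ℂ)⁻¹ *
    (SchwartzMap.derivCLM ℂ ℂ)^[n] φ 0 * h1

theorem ketBra_fPlus (n : ℕ) (φ : 𝓢(ℝ, ℂ)) :
    ketBra (fPlus n) φ = ∫ x : ℝ, φ x * fPlusFun n x := by
  rw [ketBra, braKet, fPlus_apply, ← integral_conj]
  simp [conjS_apply, fPlusFun]

theorem ketBra_fMinus (n : ℕ) (φ : 𝓢(ℝ, ℂ)) :
    ketBra (fMinus n) φ = (Real.sqrt n.factorial : ℂ)⁻¹ * (SchwartzMap.derivCLM ℂ ℂ)^[n] φ 0 := by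
  rw [ketBra, braKet, fMinus_apply, iterate_derivCLM_conjS, conjS_apply]
  simp

theorem sqrt_factorial_ne_zero (n : ℕ) : (Real.sqrt n.factorial : ℂ) ≠ 0 :=
  Complex.ofReal_ne_zero.2 (Real.sqrt_pos.2 (Nat.cast_pos.2 n.factorial_pos)).ne'

theorem sqrt_factorial_mul_self (n : ℕ) :
    (Real.sqrt n.factorial : ℂ) * Real.sqrt n.factorial = n.factorial := by
  rw [← Complex.ofReal_mul, Real.mul_self_sqrt (Nat.cast_nonneg _), Complex.ofReal_natCast]

/-- The integral of the derivative of `(x φ) x ^ n` vanishes, which trades `(x φ)'` for `-n φ` under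
the pairing; the term `-φ / 2` of `H` then turns `n + 1` into `n + 1 / 2`. -/
theorem fPlus_hamiltonian (γ : ℝ) (n : ℕ) (φ : 𝓢(ℝ, ℂ)) :
    fPlus n (hamiltonian γ φ) = -(Complex.I * γ * (n + 1 / 2) * fPlus n φ) := by
  have hint (ψ : 𝓢(ℝ, ℂ)) : Integrable (fun x => ψ x * fPlusFun n x) := by
    have := (SchwartzMap.smulLeftCLM ℂ (fPlusFun n) ψ).integrable (μ := volume)
    refine this.congr (Eventually.of_forall fun x => ?_)
    simp [SchwartzMap.smulLeftCLM_apply_apply (fPlusFun_hasTemperateGrowth n), mul_comm]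
  have hd (x : ℝ) : HasDerivAt (fun x => xOp φ x * fPlusFun n x)
      (SchwartzMap.derivCLM ℂ ℂ (xOp φ) x * fPlusFun n x + n * (φ x * fPlusFun n x)) x := by
    have h1 : HasDerivAt (fPlusFun n)
        (n * (x : ℂ) ^ (n - 1) * 1 / (Real.sqrt n.factorial : ℂ)) x :=
      ((Complex.ofRealCLM.hasDerivAt (x := x)).pow n).div_const _
    refine ((xOp φ).hasDerivAt x |>.mul h1).congr_deriv ?_
    rw [SchwartzMap.derivCLM_apply, xOp_apply, fPlusFun]
    -- The exponent `n - 1` is truncated at `n = 0`, where the factor `n` kills the term.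
    rcases n with _ | n
    · simp
    · rw [Nat.add_sub_cancel, pow_succ]
      ring
  have h0 := integral_eq_zero_of_hasDerivAt_of_integrable hd
    ((hint _).add ((hint φ).const_mul _)) (hint _)
  rw [integral_add (hint _) ((hint φ).const_mul _), integral_const_mul] at h0
  have e (x : ℝ) : hamiltonian γ φ x * fPlusFun n x =
      Complex.I * γ * (SchwartzMap.derivCLM ℂ ℂ (xOp φ) x * fPlusFun n x) +
      -(Complex.I * γ / 2) * (φ x * fPlusFun n x) := by
    rw [hamiltonian_apply, SchwartzMap.derivCLM_apply, deriv_xOp]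
    ring
  rw [fPlus_apply, fPlus_apply, integral_congr_ae (Eventually.of_forall e),
    integral_add ((hint _).const_mul _) ((hint φ).const_mul _), integral_const_mul,
    integral_const_mul]
  linear_combination Complex.I * γ * h0

/-- Leibniz' rule for a factor of degree one. At `x = 0` only the second term survives, so `δ^(n)`
is an eigenvector of the transpose of `d/dx ∘ x`. -/
theorem iterate_derivCLM_xOp (n : ℕ) (φ : 𝓢(ℝ, ℂ)) (x : ℝ) :
    (SchwartzMap.derivCLM ℂ ℂ)^[n + 1] (xOp φ) x =
      x * (SchwartzMap.derivCLM ℂ ℂ)^[n + 1] φ x +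
        (n + 1) * (SchwartzMap.derivCLM ℂ ℂ)^[n] φ x := by
  have key : (SchwartzMap.derivCLM ℂ ℂ)^[n + 1] (xOp φ) =
      xOp ((SchwartzMap.derivCLM ℂ ℂ)^[n + 1] φ) +
        ((n : ℂ) + 1) • (SchwartzMap.derivCLM ℂ ℂ)^[n] φ := by
    have hx (ψ : 𝓢(ℝ, ℂ)) : SchwartzMap.derivCLM ℂ ℂ (xOp ψ) =
        xOp (SchwartzMap.derivCLM ℂ ℂ ψ) + ψ := by
      ext y
      rw [SchwartzMap.derivCLM_apply, deriv_xOp, add_apply, xOp_apply,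
        SchwartzMap.derivCLM_apply, add_comm]
    induction n with
    | zero => simp [hx]
    | succ n ih =>
      rw [Function.iterate_succ_apply', ih, map_add, map_smul, hx,
        ← Function.iterate_succ_apply' (SchwartzMap.derivCLM ℂ ℂ) (n + 1),
        ← Function.iterate_succ_apply' (SchwartzMap.derivCLM ℂ ℂ) n]
      push_cast
      module
  rw [key, add_apply, smul_apply, xOp_apply, smul_eq_mul]

theorem fMinus_hamiltonian (γ : ℝ) (n : ℕ) (φ : 𝓢(ℝ, ℂ)) :
    fMinus n (hamiltonian γ φ) = -(-(Complex.I * γ * (n + 1 / 2)) * fMinus n φ) := by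
  have e : hamiltonian γ φ = (Complex.I * γ) • (SchwartzMap.derivCLM ℂ ℂ (xOp φ)) -
      (Complex.I * γ / 2) • φ := by
    ext x
    rw [hamiltonian_apply, sub_apply, smul_apply, smul_apply, SchwartzMap.derivCLM_apply,
      deriv_xOp, smul_eq_mul, smul_eq_mul]
    ring
  have h : fMinus n (SchwartzMap.derivCLM ℂ ℂ (xOp φ)) = (n + 1) * fMinus n φ := by
    rw [fMinus_apply, fMinus_apply, ← Function.iterate_succ_apply, iterate_derivCLM_xOp]
    simp
    ring
  rw [e, map_sub, map_smul, map_smul, h, smul_eq_mul, smul_eq_mul]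
  ring

theorem iterate_derivCLM_apply (n : ℕ) (φ : 𝓢(ℝ, ℂ)) (x : ℝ) :
    (SchwartzMap.derivCLM ℂ ℂ)^[n] φ x = iteratedDeriv n φ x := by
  induction n generalizing x with
  | zero => simp
  | succ n ih =>
    rw [Function.iterate_succ_apply', SchwartzMap.derivCLM_apply, iteratedDeriv_succ]
    congr 1
    exact funext ih

/-- A Schwartz function equal to `x ^ n` times a bump function centred at `c`. -/
theorem exists_schwartz_pow_mul_bump (n : ℕ) {c : ℝ} (b : ContDiffBump c) :
    ∃ φ : 𝓢(ℝ, ℂ), ∀ x, φ x = (x : ℂ) ^ n * (b x : ℝ) := by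
  have hb : ContDiff ℝ ∞ (fun x : ℝ => ((b x : ℝ) : ℂ)) :=
    Complex.ofRealCLM.contDiff.comp b.contDiff
  have hs : HasCompactSupport (fun x : ℝ => (x : ℂ) ^ n * ((b x : ℝ) : ℂ)) :=
    (b.hasCompactSupport.comp_left (g := fun y : ℝ => (y : ℂ)) (by simp)).mul_left
  exact ⟨hs.toSchwartzMap ((Complex.ofRealCLM.contDiff.pow n).mul hb), fun x => rfl⟩

theorem exists_fPlus_apply_ne_zero (n : ℕ) : ∃ φ : 𝓢(ℝ, ℂ), fPlus n φ ≠ 0 := by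
  let b : ContDiffBump (0 : ℝ) := ⟨1, 2, one_pos, one_lt_two⟩
  obtain ⟨φ, hφ⟩ := exists_schwartz_pow_mul_bump n b
  refine ⟨φ, ?_⟩
  have e (x : ℝ) : φ x * fPlusFun n x = ((x ^ n * b x * (x ^ n / Real.sqrt n.factorial) : ℝ) : ℂ) := by
    rw [hφ, fPlusFun]
    push_cast
    ring
  rw [fPlus_apply, integral_congr_ae (Eventually.of_forall e), integral_complex_ofReal,
    Complex.ofReal_ne_zero]
  have hs := Real.sqrt_pos.2 (Nat.cast_pos.2 n.factorial_pos : (0 : ℝ) < n.factorial)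
  refine (Continuous.integral_pos_of_hasCompactSupport_nonneg_nonzero (x := 1) ?_ ?_ ?_ ?_).ne'
  · have := b.continuous
    fun_prop
  · exact (b.hasCompactSupport.mul_left).mul_right
  · intro x
    have h1 : x ^ n * b x * (x ^ n / Real.sqrt n.factorial) =
      (x ^ n) ^ 2 * b x / Real.sqrt n.factorial := by ring
    have := b.nonneg (x := x)
    simp only [Pi.zero_apply, h1]
    positivity
  · have h1 : b 1 = 1 := b.one_of_mem_closedBall (by simp [b])
    simp [h1, hs.ne']

theorem exists_fMinus_apply_ne_zero (n : ℕ) : ∃ φ : 𝓢(ℝ, ℂ), fMinus n φ ≠ 0 := by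
  let b : ContDiffBump (0 : ℝ) := ⟨1, 2, one_pos, one_lt_two⟩
  obtain ⟨φ, hφ⟩ := exists_schwartz_pow_mul_bump n b
  refine ⟨φ, ?_⟩
  have h1 : (φ : ℝ → ℂ) =ᶠ[𝓝 0] fun x : ℝ => (x : ℂ) ^ n := by
    filter_upwards [b.eventuallyEq_one] with x hx
    simp [hφ, hx]
  -- Truncation in `n - k` is harmless, since `n.descFactorial k` vanishes for `k > n`; at `k = n`
  -- the value is `n!`.
  have h2 (k : ℕ) : deriv^[k] (fun x : ℝ => (x : ℂ) ^ n) =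
      fun x : ℝ => (n.descFactorial k : ℂ) * (x : ℂ) ^ (n - k) := by
    induction k with
    | zero => simp
    | succ k ih =>
      rw [Function.iterate_succ_apply', ih]
      funext x
      have := ((Complex.ofRealCLM.hasDerivAt (x := x)).pow (n - k)).const_mul
        (n.descFactorial k : ℂ)
      refine this.deriv.trans ?_
      simp only [Complex.ofRealCLM_apply, Complex.ofReal_one, mul_one, Nat.descFactorial_succ,
        Nat.sub_sub]
      push_cast
      ring
  rw [fMinus_apply, iterate_derivCLM_apply, h1.iteratedDeriv_eq, iteratedDeriv_eq_iterate, h2]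
  simp [Nat.descFactorial_self, n.factorial_ne_zero,
    (Real.sqrt_pos.2 (Nat.cast_pos.2 n.factorial_pos : (0 : ℝ) < n.factorial)).ne']

theorem isGenEigenvector_fMinus (γ : ℝ) (n : ℕ) :
    IsGenEigenvector (hamiltonian γ) (-(Complex.I * γ * (n + 1 / 2))) (fMinus n) :=
  isGenEigenvector_of_forall_apply (exists_fMinus_apply_ne_zero n) (fMinus_hamiltonian γ n)

theorem isGenEigenvector_fPlus (γ : ℝ) (n : ℕ) :
    IsGenEigenvector (hamiltonian γ) (Complex.I * γ * (n + 1 / 2)) (fPlus n) :=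
  isGenEigenvector_of_forall_apply (exists_fPlus_apply_ne_zero n) (fPlus_hamiltonian γ n)

/-! ### Functions of Hardy class from below -/

/-- The map `z ↦ -z` exchanges the two half-planes. It matches the index `-E` in the definition of
`Φ₊`, so only the lower half-plane needs analysis. -/
theorem HardyAbove.comp_neg {f : ℝ → ℂ} (hf : HardyAbove f) : HardyBelow (fun E => f (-E)) := by
  obtain ⟨hs, g, hd, hc, hb, hg⟩ := hf
  refine ⟨hs.comp contDiff_neg, fun z => g (-z), hd.comp (differentiable_neg.differentiableOn)
    (fun z hz => by simpa using hz), hc.comp continuous_neg.continuousOn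
    (fun z hz => by simpa using hz), fun E => by simpa using hb (-E), fun k => ?_⟩
  have ht : Tendsto (fun z : ℂ => -z) (Bornology.cobounded ℂ ⊓ 𝓟 {z | z.im ≤ 0})
      (Bornology.cobounded ℂ ⊓ 𝓟 {z | 0 ≤ z.im}) :=
    (tendsto_neg_cobounded).inf (tendsto_principal_principal.2 fun z hz => by simpa using hz)
  simpa [Function.comp_def] using (hg k).comp ht

theorem norm_exp_neg_I_mul_le_one {a : ℝ} (ha : 0 ≤ a) {z : ℂ} (hz : z.im ≤ 0) :
    ‖Complex.exp (-Complex.I * a * z)‖ ≤ 1 := by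
  rw [Complex.norm_exp, Real.exp_le_one_iff]
  simpa using mul_nonpos_of_nonneg_of_nonpos ha hz

/-- Of the rapid decay, the exponent `2` suffices: it gives integrability on the line and beats the
length of the contour. -/
theorem eventually_norm_le_of_tendsto {g : ℂ → ℂ} {s : Set ℂ}
    (hg : Tendsto (fun z : ℂ => ‖z‖ ^ 2 * ‖g z‖) (Bornology.cobounded ℂ ⊓ 𝓟 s) (𝓝 0)) :
    ∃ R : ℝ, 0 < R ∧ ∀ z ∈ s, R ≤ ‖z‖ → ‖g z‖ ≤ (‖z‖ ^ 2)⁻¹ := by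
  have h := hg.eventually (eventually_le_nhds (zero_lt_one' ℝ))
  rw [eventually_inf_principal, ← comap_norm_atTop, eventually_comap,
    eventually_atTop] at h
  obtain ⟨R, hR⟩ := h
  refine ⟨max R 1, by positivity, fun z hz hzR => ?_⟩
  have hpos : 0 < ‖z‖ := lt_of_lt_of_le (by positivity) hzR
  have := hR ‖z‖ ((le_max_left _ _).trans hzR) z rfl hz
  rwa [← mul_one (‖z‖ ^ 2)⁻¹, le_inv_mul_iff₀ (by positivity)]

theorem integrable_of_norm_le_inv_sq {f : ℝ → ℂ} (hf : Continuous f) {R : ℝ}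
    (h : ∀ x : ℝ, R ≤ |x| → ‖f x‖ ≤ (x ^ 2)⁻¹) : Integrable f := by
  refine hf.locallyIntegrable.integrable_of_isBigO_cocompact
    (g := fun x : ℝ => (1 + x ^ 2)⁻¹) ?_ (integrable_inv_one_add_sq.integrableAtFilter _)
  refine Asymptotics.IsBigO.of_bound 2 ?_
  have hev : ∀ᶠ x : ℝ in cocompact ℝ, max R 1 ≤ ‖x‖ :=
    tendsto_norm_cocompact_atTop.eventually_ge_atTop _
  filter_upwards [hev] with x hx
  have hx1 : 1 ≤ x ^ 2 := by
    rw [← sq_abs]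
    exact one_le_pow₀ ((le_max_right _ _).trans hx)
  refine (h x ((le_max_left _ _).trans hx)).trans ?_
  rw [Real.norm_of_nonneg (by positivity), ← div_eq_mul_inv, inv_eq_one_div,
    div_le_div_iff₀ (by positivity) (by positivity)]
  linarith

/-- The integral over `[-T, T]` of a function analytic in the lower half-plane is bounded through
the other three sides of the rectangle below. -/
theorem norm_intervalIntegral_le_of_differentiableOn_lower {h : ℂ → ℂ}
    (hd : DifferentiableOn ℂ h {z | z.im < 0}) (hc : ContinuousOn h {z | z.im ≤ 0})
    {T : ℝ} (hT : 0 < T) (hb : ∀ z : ℂ, z.im ≤ 0 → T ≤ ‖z‖ → ‖h z‖ ≤ (T ^ 2)⁻¹) :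
    ‖∫ x in (-T)..T, h x‖ ≤ 4 * T⁻¹ := by
  -- Cauchy's theorem on the rectangle with corners `-T - iT` and `T`. Its other three sides lie in
  -- `‖z‖ ≥ T` and have total length `4T`, whence the bound `4 / T`.
  have key := Complex.integral_boundary_rect_eq_zero_of_continuousOn_of_differentiableOn h
    (⟨-T, -T⟩ : ℂ) ⟨T, 0⟩
    (hc.mono fun z hz => by
      have := hz.2
      rw [Set.mem_preimage, Set.uIcc_of_le (by simpa using hT.le)] at this
      exact this.2)
    (hd.mono fun z hz => by
      have := hz.2.2
      simpa [hT.le] using this)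
  simp only [Complex.ofReal_zero, zero_mul, add_zero] at key
  have hbot : ‖∫ x in (-T)..T, h (x + (-T : ℝ) * Complex.I)‖ ≤ (T ^ 2)⁻¹ * |T - -T| := by
    refine intervalIntegral.norm_integral_le_of_norm_le_const fun x _ => hb _ (by simp [hT.le]) ?_
    simpa [abs_of_pos hT] using Complex.abs_im_le_norm ((x : ℂ) + (-T : ℝ) * Complex.I)
  have hside (c : ℝ) (hcT : |c| = T) :
      ‖∫ y in (-T)..0, h (c + y * Complex.I)‖ ≤ (T ^ 2)⁻¹ * |0 - -T| := by
    refine intervalIntegral.norm_integral_le_of_norm_le_const fun y hy => hb _ ?_ ?_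
    · rw [Set.uIoc_of_le (by linarith)] at hy
      simpa using hy.2
    · simpa [hcT] using Complex.abs_re_le_norm ((c : ℂ) + y * Complex.I)
  have e : ∫ x in (-T)..T, h x = (∫ x in (-T)..T, h (x + (-T : ℝ) * Complex.I)) +
      Complex.I • (∫ y in (-T)..0, h (T + y * Complex.I)) -
      Complex.I • (∫ y in (-T)..0, h ((-T : ℝ) + y * Complex.I)) := by
    linear_combination -key
  rw [e]
  refine (norm_sub_le _ _).trans ((add_le_add (norm_add_le _ _) le_rfl).trans ?_)
  rw [norm_smul, norm_smul, Complex.norm_I, one_mul, one_mul]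
  have h1 := hside T (abs_of_pos hT)
  have h2 := hside (-T) (by rw [abs_neg, abs_of_pos hT])
  rw [zero_sub, neg_neg, abs_of_pos hT] at h1 h2
  rw [sub_neg_eq_add, abs_of_pos (by positivity)] at hbot
  refine (add_le_add (add_le_add hbot h1) h2).trans (le_of_eq ?_)
  field_simp
  ring

theorem HardyBelow.integrable {f : ℝ → ℂ} (hf : HardyBelow f) : Integrable f := by
  obtain ⟨hs, g, -, -, hb, hg⟩ := hf
  obtain ⟨R, -, hgR⟩ := eventually_norm_le_of_tendsto (hg 2)
  refine integrable_of_norm_le_inv_sq hs.continuous (R := R) fun x hx => ?_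
  simpa [hb] using hgR x (by simp) (by simpa using hx)

/-- The Fourier transform of a function of Hardy class from below vanishes on a half-line. -/
theorem HardyBelow.integral_exp_mul_eq_zero {f : ℝ → ℂ} (hf : HardyBelow f) {a : ℝ} (ha : 0 ≤ a) :
    ∫ E : ℝ, Complex.exp (-Complex.I * a * E) * f E = 0 := by
  have hint : Integrable (fun E : ℝ => Complex.exp (-Complex.I * a * E) * f E) := by
    refine hf.integrable.bdd_mul (c := 1) (by fun_prop) (Eventually.of_forall fun E => ?_)
    exact norm_exp_neg_I_mul_le_one ha (by simp)
  obtain ⟨-, g, hd, hc, hb, hg⟩ := hf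
  obtain ⟨R, hR, hgR⟩ := eventually_norm_le_of_tendsto (hg 2)
  have hlim := intervalIntegral_tendsto_integral hint tendsto_neg_atTop_atBot tendsto_id
  refine tendsto_nhds_unique hlim (squeeze_zero_norm' ?_
    (by simpa using tendsto_inv_atTop_zero.const_mul (4 : ℝ)))
  filter_upwards [eventually_ge_atTop R] with T hT
  have hT0 : 0 < T := hR.trans_le hT
  have := norm_intervalIntegral_le_of_differentiableOn_lower
    (h := fun z => Complex.exp (-Complex.I * a * z) * g z)
    ((by fun_prop : Differentiable ℂ fun z : ℂ => Complex.exp (-Complex.I * a * z)).differentiableOn.mul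
      hd) ((by fun_prop : Continuous fun z : ℂ => Complex.exp (-Complex.I * a * z)).continuousOn.mul hc)
    hT0 (fun z hz hzT => by
      rw [norm_mul]
      refine (mul_le_of_le_one_left (norm_nonneg _) (norm_exp_neg_I_mul_le_one ha hz)).trans ?_
      refine (hgR z hz (hT.trans hzT)).trans ?_
      gcongr)
  simpa only [hb, id] using this

/-! ### Support of the functions in `Φ₋` -/

/-- Conjugation turns the exponent `-(iE/γ + 1/2)` into `s - 1` with `s = 1/2 + iE/γ`, the Mellin
kernel on the line `Re s = 1/2`. -/
theorem ketBra_psiPlus (γ E : ℝ) (φ : 𝓢(ℝ, ℂ)) :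
    ketBra (psiPlus γ E) φ = (((Real.sqrt (2 * Real.pi * γ))⁻¹ : ℝ) : ℂ) *
      mellin φ ((1 / 2 : ℝ) + (E / γ : ℝ) * Complex.I) := by
  have h : braKet φ (psiPlus γ E) = (((Real.sqrt (2 * Real.pi * γ))⁻¹ : ℝ) : ℂ) *
    ∫ x, xPlus (expo γ E) x * conjS φ x := rfl
  rw [ketBra, h, map_mul, Complex.conj_ofReal, ← integral_conj, mellin]
  congr 1
  rw [← integral_indicator measurableSet_Ioi]
  have h0 : ∀ᵐ x : ℝ, x ≠ 0 := by simp [ae_iff, measure_singleton]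
  refine integral_congr_ae ?_
  filter_upwards [h0] with x hx
  rcases lt_or_gt_of_ne hx with hx | hx
  · simp [xPlus, hx.not_ge, hx.le]
  · have hl : (starRingEnd ℂ) ((x : ℂ) ^ expo γ E) = (x : ℂ) ^ (starRingEnd ℂ) (expo γ E) := by
      rw [Complex.cpow_conj _ _ (by simp [Complex.arg_ofReal_of_nonneg hx.le, Real.pi_ne_zero.symm]),
        Complex.conj_ofReal]
    rw [Set.indicator_of_mem (Set.mem_Ioi.2 hx), map_mul, conjS_apply, Complex.conj_conj, xPlus,
      if_pos hx.le, hl, smul_eq_mul]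
    congr 2
    simp only [expo, map_neg, map_add, map_div₀, map_mul, Complex.conj_I, Complex.conj_ofReal,
      map_one, map_ofNat]
    push_cast
    ring

theorem mellinConvergent_half (φ : 𝓢(ℝ, ℂ)) : MellinConvergent φ ((1 / 2 : ℝ) : ℂ) := by
  have h := ((weightIntegrable_xPlus (l := -1 / 2) (by norm_num)).integrable_mul φ).integrableOn
    (s := Set.Ioi 0)
  refine h.congr_fun (fun x hx => ?_) measurableSet_Ioi
  have hx : 0 < x := hx
  simp only [xPlus, if_pos hx.le, smul_eq_mul]
  congr 2
  push_cast
  ring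

/-- Mellin inversion on `Re s = 1/2` followed by `E = γ y` produces the frequency `a = log x / γ`,
and `x ≥ 1` is exactly what makes `a ≥ 0`. -/
theorem eq_zero_of_hardyBelow_psiPlus {γ : ℝ} (hγ : 0 < γ) {φ : 𝓢(ℝ, ℂ)}
    (hφ : HardyBelow (fun E => ketBra (psiPlus γ E) φ)) {x : ℝ} (hx : 1 ≤ x) : φ x = 0 := by
  have hx0 : 0 < x := one_pos.trans_le hx
  set c : ℂ := (((Real.sqrt (2 * Real.pi * γ))⁻¹ : ℝ) : ℂ) with hc
  have hc0 : c ≠ 0 := by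
    have := Real.sqrt_pos.2 (by positivity : 0 < 2 * Real.pi * γ)
    simp [hc, this.ne']
  have hM (y : ℝ) : mellin φ ((1 / 2 : ℝ) + y * Complex.I) =
      c⁻¹ * ketBra (psiPlus γ (γ * y)) φ := by
    rw [ketBra_psiPlus, ← hc, inv_mul_cancel_left₀ hc0, mul_div_cancel_left₀ _ hγ.ne']
  have hV : Complex.VerticalIntegrable (mellin φ) (1 / 2) := by
    refine ((hφ.integrable.comp_mul_left' hγ.ne').const_mul c⁻¹).congr
      (Eventually.of_forall fun y => ?_)
    exact (hM y).symm
  rw [← mellinInv_mellin_eq (1 / 2) φ hx0 (mellinConvergent_half φ) hV φ.continuous.continuousAt,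
    mellinInv]
  have e (y : ℝ) : (x : ℂ) ^ (-(((1 / 2 : ℝ) : ℂ) + y * Complex.I)) •
      mellin φ ((1 / 2 : ℝ) + y * Complex.I) = ((x : ℂ) ^ (-((1 / 2 : ℝ) : ℂ)) * c⁻¹) *
      (fun E : ℝ => Complex.exp (-Complex.I * (Real.log x / γ : ℝ) * E) *
        ketBra (psiPlus γ E) φ) (γ * y) := by
    have hxc : (x : ℂ) ≠ 0 := Complex.ofReal_ne_zero.2 hx0.ne'
    have he : (x : ℂ) ^ (-(y * Complex.I)) =
        Complex.exp (-Complex.I * (Real.log x / γ : ℝ) * (γ * y : ℝ)) := by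
      rw [Complex.cpow_def_of_ne_zero hxc, ← Complex.ofReal_log hx0.le]
      congr 1
      have : (γ : ℂ) ≠ 0 := Complex.ofReal_ne_zero.2 hγ.ne'
      push_cast
      field_simp
    rw [hM, smul_eq_mul, neg_add, Complex.cpow_add _ _ hxc, he]
    ring
  rw [integral_congr_ae (Eventually.of_forall e), integral_const_mul,
    Measure.integral_comp_mul_left (fun E : ℝ =>
      Complex.exp (-Complex.I * (Real.log x / γ : ℝ) * E) * ketBra (psiPlus γ E) φ),
    hφ.integral_exp_mul_eq_zero (div_nonneg (Real.log_nonneg hx) hγ.le)]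
  simp

/-- The reflection `x ↦ φ (-x)` of a Schwartz function. -/
noncomputable def reflect : 𝓢(ℝ, ℂ) →L[ℂ] 𝓢(ℝ, ℂ) :=
  SchwartzMap.compCLMOfContinuousLinearEquiv ℂ (ContinuousLinearEquiv.neg ℝ)

theorem reflect_apply (φ : 𝓢(ℝ, ℂ)) (x : ℝ) : reflect φ x = φ (-x) := rfl

theorem ketBra_psiMinus (γ E : ℝ) (φ : 𝓢(ℝ, ℂ)) :
    ketBra (psiMinus γ E) φ = ketBra (psiPlus γ E) (reflect φ) := by
  have h1 : psiMinus γ E (conjS φ) = (((Real.sqrt (2 * Real.pi * γ))⁻¹ : ℝ) : ℂ) *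
    ∫ x, xMinus (expo γ E) x * conjS φ x := rfl
  have h2 : psiPlus γ E (conjS (reflect φ)) = (((Real.sqrt (2 * Real.pi * γ))⁻¹ : ℝ) : ℂ) *
    ∫ x, xPlus (expo γ E) x * conjS (reflect φ) x := rfl
  rw [ketBra, ketBra, braKet, braKet, h1, h2,
    ← integral_neg_eq_self (fun x => xMinus (expo γ E) x * conjS φ x)]
  congr 2
  have h0 : ∀ᵐ x : ℝ, x ≠ 0 := by simp [ae_iff, measure_singleton]
  refine integral_congr_ae ?_
  filter_upwards [h0] with x hx
  rw [conjS_apply, conjS_apply, reflect_apply]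
  rcases lt_or_gt_of_ne hx with hx | hx
  · simp [xPlus, xMinus, hx.not_ge, hx.le]
  · simp [xPlus, xMinus, hx.not_ge, hx.le, abs_of_pos hx]

theorem eq_zero_of_mem_PhiMinus {γ : ℝ} (hγ : 0 < γ) {φ : 𝓢(ℝ, ℂ)} (hφ : φ ∈ PhiMinus γ)
    {x : ℝ} (hx : 1 ≤ |x|) : φ x = 0 := by
  rcases le_abs.1 hx with h | h
  · exact eq_zero_of_hardyBelow_psiPlus hγ hφ.1 h
  · have h2 := hφ.2
    simp only [ketBra_psiMinus] at h2
    simpa [reflect_apply] using eq_zero_of_hardyBelow_psiPlus hγ h2 h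

/-! ### Fourier transforms of functions with bounded support -/

theorem hasDerivAt_fourierS (η : 𝓢(ℝ, ℂ)) (k : ℝ) :
    HasDerivAt (fourierS η) (fourierS (Complex.I • xOp η) k) k := by
  have hm (k : ℝ) (ψ : 𝓢(ℝ, ℂ)) : AEStronglyMeasurable
      (fun x : ℝ => Complex.exp (Complex.I * k * x) * ψ x) := by
    have := ψ.continuous
    exact Continuous.aestronglyMeasurable (by fun_prop)
  have hn (k x : ℝ) : ‖Complex.exp (Complex.I * k * x)‖ = 1 := by
    rw [mul_assoc, ← Complex.ofReal_mul, mul_comm, Complex.norm_exp_ofReal_mul_I]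
  have h := (hasDerivAt_integral_of_dominated_loc_of_deriv_le (μ := volume) (x₀ := k)
    (F := fun k x => Complex.exp (Complex.I * (k : ℝ) * (x : ℝ)) * η x)
    (F' := fun k x => Complex.exp (Complex.I * (k : ℝ) * (x : ℝ)) * (Complex.I • xOp η) x)
    (bound := fun x => ‖(Complex.I • xOp η) x‖) univ_mem
    (Eventually.of_forall fun k => hm k η)
    (η.integrable.bdd_mul (c := 1) (by fun_prop)
      (Eventually.of_forall fun x => (hn k x).le))
    (hm k _) (Eventually.of_forall fun x k _ => by rw [norm_mul, hn, one_mul])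
    (SchwartzMap.integrable _).norm (Eventually.of_forall fun x k _ => by
      have h1 : HasDerivAt (fun k : ℝ => Complex.I * (k : ℂ) * x) (Complex.I * 1 * x) k :=
        ((Complex.ofRealCLM.hasDerivAt (x := k)).const_mul Complex.I).mul_const _
      refine (h1.cexp.mul_const (η x)).congr_deriv ?_
      rw [smul_apply, xOp_apply, smul_eq_mul]
      ring)).2.const_mul (((Real.sqrt (2 * Real.pi))⁻¹ : ℝ) : ℂ)
  rw [fourierS_apply, funext (fourierS_apply η)]
  exact h

theorem iterate_derivCLM_fourierS (n : ℕ) (η : 𝓢(ℝ, ℂ)) :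
    (SchwartzMap.derivCLM ℂ ℂ)^[n] (fourierS η) 0 = (((Real.sqrt (2 * Real.pi))⁻¹ : ℝ) : ℂ) *
      ∫ x : ℝ, (Complex.I * x) ^ n * η x := by
  -- The transform intertwines multiplication by `i x` with `d/dk`, so the `n`-th derivative at `0`
  -- is an `n`-th moment.
  have h : Function.Semiconj fourierS (fun ψ : 𝓢(ℝ, ℂ) => Complex.I • xOp ψ)
      (SchwartzMap.derivCLM ℂ ℂ) := fun ψ => by
    ext k
    rw [SchwartzMap.derivCLM_apply, (hasDerivAt_fourierS ψ k).deriv]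
  have hi (x : ℝ) : (fun ψ : 𝓢(ℝ, ℂ) => Complex.I • xOp ψ)^[n] η x =
      (Complex.I * x) ^ n * η x := by
    induction n with
    | zero => simp
    | succ n ih =>
      rw [Function.iterate_succ_apply', smul_apply, xOp_apply, ih, smul_eq_mul]
      ring
  rw [← (h.iterate_right n) η, fourierS_apply]
  simp [hi]

theorem norm_pow_mul_le_of_support {η : 𝓢(ℝ, ℂ)} {R : ℝ} (hη : ∀ x : ℝ, R < |x| → η x = 0)
    (n : ℕ) (x : ℝ) : |x| ^ n * ‖η x‖ ≤ R ^ n * ‖η x‖ := by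
  rcases lt_or_ge R |x| with h | h
  · simp [hη x h]
  · gcongr

theorem norm_iterate_derivCLM_fourierS_le {η : 𝓢(ℝ, ℂ)} {R : ℝ}
    (hη : ∀ x : ℝ, R < |x| → η x = 0) :
    ∃ C : ℝ, ∀ n : ℕ, ‖(SchwartzMap.derivCLM ℂ ℂ)^[n] (fourierS η) 0‖ ≤ C * R ^ n := by
  refine ⟨(Real.sqrt (2 * Real.pi))⁻¹ * ∫ x, ‖η x‖, fun n => ?_⟩
  rw [iterate_derivCLM_fourierS, norm_mul, Complex.norm_real, Real.norm_of_nonneg (by positivity),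
    mul_assoc, mul_comm (∫ x, ‖η x‖), ← integral_const_mul]
  gcongr
  refine norm_integral_le_of_norm_le (η.integrable.norm.const_mul _)
    (Eventually.of_forall fun x => ?_)
  simpa using norm_pow_mul_le_of_support hη n x

/-- Termwise integration, dominated by `b n * ‖φ x‖`. The bound on `p n` is needed only where `φ`
does not vanish, so bounded support makes polynomials admissible. -/
theorem hasSum_integral_mul_of_summable {φ : 𝓢(ℝ, ℂ)} {p : ℕ → ℝ → ℂ} {f : ℝ → ℂ} {b : ℕ → ℝ}
    (hp : ∀ n, Continuous (p n)) (hb : Summable b) (hle : ∀ n x, ‖p n x * φ x‖ ≤ b n * ‖φ x‖)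
    (hf : ∀ x, HasSum (fun n => p n x) (f x)) :
    HasSum (fun n => ∫ x, p n x * φ x) (∫ x, f x * φ x) := by
  have hint (n : ℕ) : Integrable (fun x => p n x * φ x) :=
    (φ.integrable.norm.const_mul (b n)).mono'
      ((hp n).mul φ.continuous).aestronglyMeasurable (Eventually.of_forall (hle n))
  have h := hasSum_integral_of_summable_integral_norm hint
    ((hb.mul_right (∫ x, ‖φ x‖)).of_nonneg_of_le
      (fun n => integral_nonneg fun x => norm_nonneg _) fun n => by
        rw [← integral_const_mul]
        exact integral_mono (hint n).norm (φ.integrable.norm.const_mul _) (hle n))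
  simpa only [((hf _).mul_right _).tsum_eq] using h

/-- The Fourier transform of a function with bounded support is the sum of its Taylor series. -/
theorem hasSum_taylor_fourierS {η : 𝓢(ℝ, ℂ)} {R : ℝ} (hη : ∀ x : ℝ, R < |x| → η x = 0) (k : ℝ) :
    HasSum (fun n : ℕ => (SchwartzMap.derivCLM ℂ ℂ)^[n] (fourierS η) 0 / n.factorial * (k : ℂ) ^ n)
      (fourierS η k) := by
  have h := (hasSum_integral_mul_of_summable (φ := η)
    (p := fun n x => (Complex.I * k * x) ^ n / n.factorial)
    (f := fun x => Complex.exp (Complex.I * k * x)) (b := fun n => (|k| * R) ^ n / n.factorial)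
    (fun n => by fun_prop) (Real.summable_pow_div_factorial _) (fun n x => by
      have := mul_le_mul_of_nonneg_left (norm_pow_mul_le_of_support hη n x)
        (by positivity : 0 ≤ |k| ^ n / n.factorial)
      simp only [norm_mul, norm_div, norm_pow, Complex.norm_I, Complex.norm_real,
        Real.norm_eq_abs, Complex.norm_natCast, mul_pow]
      calc _ = |k| ^ n / n.factorial * (|x| ^ n * ‖η x‖) := by ring
        _ ≤ _ := this
        _ = _ := by ring)
    (fun x => by
      rw [Complex.exp_eq_exp_ℂ]
      exact NormedSpace.expSeries_div_hasSum_exp _)).mul_left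
      (((Real.sqrt (2 * Real.pi))⁻¹ : ℝ) : ℂ)
  rw [fourierS_apply]
  refine h.congr_fun fun n => ?_
  rw [iterate_derivCLM_fourierS, mul_div_assoc, mul_assoc, ← integral_div, ← integral_mul_const]
  congr 2
  funext x
  ring

/-- Conjugating by complex conjugation changes `exp (ikx)` into `exp (-ikx)`, so `conj F conj`
inverts `F`. The substitution `x = 2π y` reduces this to inversion in Mathlib's normalisation. -/
theorem fourierS_conjS_fourierS_conjS (φ : 𝓢(ℝ, ℂ)) :
    fourierS (conjS (fourierS (conjS φ))) = φ := by
  ext k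
  set c : ℂ := (((Real.sqrt (2 * Real.pi))⁻¹ : ℝ) : ℂ) with hc
  have hc2 : c * c * (2 * Real.pi : ℝ) = 1 := by
    rw [hc, ← Complex.ofReal_mul, ← Complex.ofReal_mul, ← mul_inv,
      Real.mul_self_sqrt (by positivity), inv_mul_cancel₀ (by positivity), Complex.ofReal_one]
  have h1 (y : ℝ) : conjS (fourierS (conjS φ)) (2 * Real.pi * y) =
      c * FourierTransform.fourier φ y := by
    rw [conjS_apply, fourierS_apply, map_mul, Complex.conj_ofReal, ← integral_conj,
      SchwartzMap.fourier_coe, Real.fourier_eq']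
    congr 2
    funext x
    rw [conjS_apply, map_mul, Complex.conj_conj, ← Complex.exp_conj, smul_eq_mul]
    congr 2
    simp only [map_mul, Complex.conj_I, Complex.conj_ofReal, RCLike.inner_apply, conj_trivial]
    push_cast
    ring
  have h2 := Measure.integral_comp_mul_left
    (fun x : ℝ => Complex.exp (Complex.I * k * x) * conjS (fourierS (conjS φ)) x) (2 * Real.pi)
  have h3 : φ k = ∫ y : ℝ, Complex.exp (Complex.I * k * (2 * Real.pi * y : ℝ)) *
      FourierTransform.fourier φ y := by
    have hφ : FourierTransform.fourierInv (FourierTransform.fourier φ) = φ :=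
      FourierTransform.fourierInv_fourier_eq φ
    conv_lhs => rw [← hφ, SchwartzMap.fourierInv_coe, Real.fourierInv_eq']
    congr 1
    funext x
    rw [smul_eq_mul]
    congr 2
    simp only [RCLike.inner_apply, conj_trivial]
    push_cast
    ring
  simp only [h1, mul_left_comm _ c, integral_const_mul] at h2
  rw [← h3, abs_of_pos (by positivity), Complex.real_smul, Complex.ofReal_inv,
    eq_inv_mul_iff_mul_eq₀ (Complex.ofReal_ne_zero.2 Real.two_pi_pos.ne')] at h2
  rw [fourierS_apply, ← hc, ← h2]
  linear_combination φ k * hc2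

theorem ketBra_fourierD (T : 𝓢'(ℝ, ℂ)) (φ : 𝓢(ℝ, ℂ)) :
    ketBra (fourierD T) φ = ketBra T (conjS (fourierS (conjS φ))) := by
  rw [ketBra, ketBra, braKet, braKet, conjS_conjS]
  rfl

/-- Duality moves `F` from `ψ^(-E)_±` to the test function, where it becomes `conj F conj`;
replacing `E` by `-E` then turns Hardy above into Hardy below. -/
theorem conjS_fourierS_conjS_mem_PhiMinus {γ : ℝ} {φ : 𝓢(ℝ, ℂ)} (hφ : φ ∈ PhiPlus γ) :
    conjS (fourierS (conjS φ)) ∈ PhiMinus γ := by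
  have h1 := hφ.1.comp_neg
  have h2 := hφ.2.comp_neg
  simp only [ketBra_fourierD, neg_neg] at h1 h2
  exact ⟨h1, h2⟩

/-! ### The resonant expansions -/

theorem hasSum_fMinus_mul_ketBra_fPlus {γ : ℝ} (hγ : 0 < γ) {φ χ : 𝓢(ℝ, ℂ)}
    (hφ : φ ∈ PhiMinus γ) (hχ : χ ∈ spaceZ) :
    HasSum (fun n : ℕ => fMinus n χ * ketBra (fPlus n) φ) (∫ x : ℝ, φ x * χ x) := by
  obtain ⟨u, hu, rfl⟩ := hχ
  obtain ⟨R, hR⟩ := hu.isCompact.isBounded.subset_closedBall 0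
  have huR (x : ℝ) (hx : R < |x|) : u x = 0 := by
    by_contra h
    have := hR (subset_tsupport u h)
    rw [mem_closedBall_zero_iff, Real.norm_eq_abs] at this
    linarith
  obtain ⟨C, hC⟩ := norm_iterate_derivCLM_fourierS_le huR
  have h := hasSum_integral_mul_of_summable (φ := φ) (f := fourierS u)
    (p := fun n x => (SchwartzMap.derivCLM ℂ ℂ)^[n] (fourierS u) 0 / n.factorial * (x : ℂ) ^ n)
    (b := fun n => C * (R ^ n / n.factorial))
    (fun n => by fun_prop) ((Real.summable_pow_div_factorial R).mul_left C) (fun n x => by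
      have h1 := norm_pow_mul_le_of_support (η := φ) (R := 1)
        (fun x hx => eq_zero_of_mem_PhiMinus hγ hφ hx.le) n x
      rw [one_pow, one_mul] at h1
      rw [mul_assoc, norm_mul, norm_div, Complex.norm_natCast, norm_mul, norm_pow,
        Complex.norm_real, Real.norm_eq_abs, ← mul_div_assoc]
      -- The signs of `C` and `R` are unknown, but `C * R ^ n` bounds a norm and so is nonnegative.
      have := (norm_nonneg _).trans (hC n)
      gcongr
      exact hC n)
    (hasSum_taylor_fourierS huR)
  simp only [mul_comm (φ _)]
  refine h.congr_fun fun n => ?_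
  rw [fMinus_apply, ketBra_fPlus, ← integral_const_mul]
  congr 1
  funext x
  -- The factors `1 / √(n!)` from `f⁻_n` and `f⁺_n` combine into the Taylor coefficient's `1 / n!`.
  rw [fPlusFun, ← sqrt_factorial_mul_self]
  have := sqrt_factorial_ne_zero n
  field_simp

theorem hasSum_fPlusFun_mul_ketBra_fMinus {γ : ℝ} (hγ : 0 < γ) {φ : 𝓢(ℝ, ℂ)}
    (hφ : φ ∈ PhiPlus γ) (x : ℝ) :
    HasSum (fun n : ℕ => fPlusFun n x * ketBra (fMinus n) φ) (φ x) := by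
  have h := hasSum_taylor_fourierS (R := 1)
    (fun x hx => eq_zero_of_mem_PhiMinus hγ (conjS_fourierS_conjS_mem_PhiMinus hφ) hx.le) x
  rw [fourierS_conjS_fourierS_conjS] at h
  refine h.congr_fun fun n => ?_
  rw [ketBra_fMinus, fPlusFun, ← sqrt_factorial_mul_self]
  have := sqrt_factorial_ne_zero n
  field_simp

end DampedSystem

theorem mainTheorem1 (γ : ℝ) (hγ : 0 < γ) :
    (∀ n : ℕ,
      DampedSystem.IsGenEigenvector (DampedSystem.hamiltonian γ)
        (-(Complex.I * γ * (n + 1 / 2))) (DampedSystem.fMinus n) ∧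
      DampedSystem.IsGenEigenvector (DampedSystem.hamiltonian γ)
        (Complex.I * γ * (n + 1 / 2)) (DampedSystem.fPlus n)) ∧
    (∀ φ ∈ DampedSystem.PhiMinus γ, ∀ χ ∈ DampedSystem.spaceZ,
      HasSum (fun n : ℕ => DampedSystem.fMinus n χ * DampedSystem.ketBra (DampedSystem.fPlus n) φ)
        (∫ x : ℝ, φ x * χ x)) ∧
    (∀ φ ∈ DampedSystem.PhiPlus γ, ∀ x : ℝ,
      HasSum (fun n : ℕ => DampedSystem.fPlusFun n x * DampedSystem.ketBra (DampedSystem.fMinus n) φ)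
        (φ x)) :=
  ⟨fun n => ⟨DampedSystem.isGenEigenvector_fMinus γ n, DampedSystem.isGenEigenvector_fPlus γ n⟩,
    fun _ hφ _ hχ => DampedSystem.hasSum_fMinus_mul_ketBra_fPlus hγ hφ hχ,
    fun _ hφ x => DampedSystem.hasSum_fPlusFun_mul_ketBra_fMinus hγ hφ x⟩
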